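/- **Setting.** Let $y_A,y_B,p_A,p_B>0$, $f\ge 0$ and $\hat g_L\ge 0$ (reserves of a constant product pool, prices of the two assets on a centralized exchange, proportional trading fee, base gas fee). Put $$O=\frac{y_Bp_B}{y_Ap_A(1+f)},\qquad \hat D_A=\sqrt{\frac{y_Ay_Bp_B}{p_A(1+f)}}-y_A,\qquad \hat g_H=(1+f)p_Ay_A\left(\sqrt{\frac{p_By_B}{(1+f)p_Ay_A}}-1\right)^2,$$ and assume $1<O\le 3$ and $\hat g_L<\hat g_H$. For a gas fee $g$ and trading amounts $d,\bar d\ge 0$ let $$R_F(g,d)=d\left(\frac{y_B}{y_A+d}p_B-(1+f)p_A\right)-g,\qquad R_S(g,d;\bar d)=R_F(g,d)-V(d;\bar d),$$ $$V(d;\bar d)=\left[\frac{d}{y_A+d}-\frac{d\,y_A}{(y_A+\bar d)(y_A+\bar d+d)}\right]y_Bp_B$$ be the profits of the first and of the second mover (the competitor trading $\bar d$ first). **Game.** Two arbitrageurs independently choose mixed strategies $(\alpha,\mu)$, where $\alpha\in[0,1]$ is the probability of trading and $\mu$, a probability measure on $[\hat g_L,\hat g_H]\times[0,\hat D_A]$,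 is the law of the gas fee and the trading amount given that one trades. The payoff of an arbitrageur is $0$ if she does not trade. If she trades with $(g,d)$, it is $R_F(g,d)$ if the competitor does not trade; if he trades with $(\bar g,\bar d)$, it is $R_F(g,d)$ for $g>\bar g$, $R_S(g,d;\bar d)$ for $g<\bar g$, and $\frac12(R_F(g,d)+R_S(g,d;\bar d))$ for $g=\bar g$. Let $\Pi(\alpha,\mu;\bar\alpha,\bar\mu)$ be the expected payoff. A mixed strategy $(\alpha^*,\mu^*)$ is a symmetric mixed Nash equilibrium if $\Pi(\alpha,\mu;\alpha^*,\mu^*)\le\Pi(\alpha^*,\mu^*;\alpha^*,\mu^*)$ for all mixed strategies $(\alpha,\mu)$. Let $\mathcal A$ be the class of triples $(\alpha,\Phi,D_A)$ such that $\alpha\in(0,1]$, $\Phi$ is a probability measure whose support is $[\hat g_L,g_H]$ for some $g_H\in(\hat g_L,\hat g_H]$ and which has a density $\phi$ that is continuous on its support, and $D_A$ is continuous on the support of $\Phi$. The triple stands for the mixed strategy $(\alpha,\mu)$, where $\mu$ is the law of $(g,D_A(g))$ for $g$ distributed according to $\Phi$. **Proposition.** Let $(\alpha^*,\Phi^*,D_A^*)\in\mathcal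 A$ be a symmetric mixed Nash equilibrium, and let $\phi^*$ be the continuous density of $\Phi^*$ on its support $[\hat g_L,g_H]$. Then: (i) $D_A^*$ is strictly increasing on $[\hat g_L,g_H]$, and $D_A^*(g_H)=\hat D_A$; (ii) $\phi^*$ is strictly decreasing on $[\hat g_L,g_H]$. -/

import Mathlib

open MeasureTheory Set

noncomputable section

namespace GasGame

/-- A constant product pool with reserves `yA`, `yB` of the assets A and B and proportional trading
fee `f`, the prices `pA`, `pB` of the assets on the centralized exchange, and the base gas fee
`gL`. -/
structure Market where
  yA : ℝ
  yB : ℝ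
  pA : ℝ
  pB : ℝ
  f : ℝ
  gL : ℝ

namespace Market

variable (m : Market)

/-- The level of liquidity. -/
def LB : ℝ := m.yB * m.pB

/-- The size of the arbitrage opportunity. -/
def O : ℝ := m.yB * m.pB / (m.yA * m.pA * (1 + m.f))

/-- The net profit of the first mover with gas fee `g` who deposits the amount `d` of asset A. -/
def RF (g d : ℝ) : ℝ :=
  d * (m.yB / (m.yA + d) * m.pB - (1 + m.f) * m.pA) - g

/-- The first-mover advantage, for the trading amount `d` against the amount `d'` of the
competitor. -/
def V (d d' : ℝ) : ℝ :=
  (d / (m.yA + d) - d * m.yA / ((m.yA + d') * (m.yA + d' + d))) * m.yB * m.pB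

/-- The net profit of the second mover with gas fee `g` and trading amount `d`, when the trade `d'`
of the competitor has been executed before. -/
def RS (g d d' : ℝ) : ℝ := m.RF g d - m.V d d'

/-- The optimal trading amount of the first mover. -/
def hatD : ℝ := √(m.yA * m.yB * m.pB / (m.pA * (1 + m.f))) - m.yA

/-- The highest profitable gas fee. -/
def hatG : ℝ :=
  (1 + m.f) * m.pA * m.yA * (√(m.pB * m.yB / ((1 + m.f) * m.pA * m.yA)) - 1) ^ 2

/-- The standing assumptions: positive reserves and prices, a nonnegative trading fee and a
nonnegative base gas fee, an arbitrage opportunity, and a base gas fee below the highest profitable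
gas fee. -/
structure Standing : Prop where
  yA_pos : 0 < m.yA
  yB_pos : 0 < m.yB
  pA_pos : 0 < m.pA
  pB_pos : 0 < m.pB
  f_nonneg : 0 ≤ m.f
  gL_nonneg : 0 ≤ m.gL
  one_lt_O : 1 < m.O
  gL_lt_hatG : m.gL < m.hatG

/-- The pairs of a gas fee and a trading amount which are available to an arbitrageur who trades. -/
def actions : Set (ℝ × ℝ) := Icc m.gL m.hatG ×ˢ Icc 0 m.hatD

/-- The payoff of the action `a` (gas fee, trading amount) against the action `b` when both
arbitrageurs trade: the higher gas fee is executed first, and ties are broken by a fair coin. -/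
def payoff (a b : ℝ × ℝ) : ℝ :=
  if b.1 < a.1 then m.RF a.1 a.2
  else if b.1 = a.1 then (1 / 2) * (m.RF a.1 a.2 + m.RS a.1 a.2 b.2)
  else m.RS a.1 a.2 b.2

/-- The expected payoff of trading with probability `α` and then choosing the action at random with
law `μ`, against an independent competitor who does the same with `α'` and `μ'`. -/
def expectedPayoff (α : ℝ) (μ : Measure (ℝ × ℝ)) (α' : ℝ) (μ' : Measure (ℝ × ℝ)) : ℝ :=
  α * (1 - α') * ∫ a, m.RF a.1 a.2 ∂μ + α * α' * ∫ p, m.payoff p.1 p.2 ∂(μ.prod μ')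

/-- `(α, μ)` is a mixed strategy: `α` is a probability and `μ` is a probability measure on the
available actions. -/
def IsMixedStrategy (α : ℝ) (μ : Measure (ℝ × ℝ)) : Prop :=
  α ∈ Icc (0 : ℝ) 1 ∧ IsProbabilityMeasure μ ∧ μ m.actionsᶜ = 0

/-- `(α, μ)` is a symmetric mixed Nash equilibrium: it is a best response to itself among all mixed
strategies. -/
def IsSymmetricMixedNash (α : ℝ) (μ : Measure (ℝ × ℝ)) : Prop :=
  m.IsMixedStrategy α μ ∧
    ∀ (β : ℝ) (ν : Measure (ℝ × ℝ)), m.IsMixedStrategy β ν →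
      m.expectedPayoff β ν α μ ≤ m.expectedPayoff α μ α μ

end Market

/-- A strategy `(α, Φ, D)`: trade with probability `α`, choose the gas fee with law `Φ`, and trade
the amount `D g` when the gas fee is `g`. -/
structure Strategy where
  α : ℝ
  Φ : Measure ℝ
  D : ℝ → ℝ

/-- The joint law of the gas fee and the trading amount, given that a trade takes place. -/
def Strategy.law (σ : Strategy) : Measure (ℝ × ℝ) := σ.Φ.map fun g => (g, σ.D g)

namespace Market

variable (m : Market)

/-- The strategy `σ` is in the class of strategies with `α ∈ (0, 1]` whose gas fee law has support
`[gL, gH]` for some `gH ∈ (gL, hatG]` and has a density which is continuous on the support, and whose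
trading amount is continuous on the support; here `gH` is the upper end of the support and `φ` is
the density. -/
structure InClass (σ : Strategy) (gH : ℝ) (φ : ℝ → ℝ) : Prop where
  α_mem : σ.α ∈ Ioc (0 : ℝ) 1
  isProb : IsProbabilityMeasure σ.Φ
  gH_mem : gH ∈ Ioc m.gL m.hatG
  support_eq : σ.Φ.support = Icc m.gL gH
  density_nonneg : ∀ g ∈ Icc m.gL gH, 0 ≤ φ g
  density_cont : ContinuousOn φ (Icc m.gL gH)
  density_eq : σ.Φ = (volume.restrict (Icc m.gL gH)).withDensity fun g => ENNReal.ofReal (φ g)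
  amount_cont : ContinuousOn σ.D (Icc m.gL gH)

/-- The second mover faces the reserves left by the competitor, whose trade `d'` has changed them
to `yA + d'` and `yA * yB / (yA + d')`. -/
theorem RS_eq (hm : m.Standing) {g d d' : ℝ} (hd : 0 ≤ d) (hd' : 0 ≤ d') :
    m.RS g d d' =
      d * (m.yA * m.yB / (m.yA + d') / (m.yA + d' + d) * m.pB - (1 + m.f) * m.pA) - g := by
  have h1 := hm.yA_pos
  have h2 : m.yA + d ≠ 0 := by positivity
  have h3 : m.yA + d' ≠ 0 := by positivity
  have h4 : m.yA + d' + d ≠ 0 := by positivity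
  unfold RS RF V
  field_simp
  ring

/-- The sense in which `hatD` is optimal and `hatG` is the highest profitable gas fee: the best
profit of a first mover with gas fee `g` is `hatG - g`, and it is attained exactly at `hatD`. -/
theorem RF_le (hm : m.Standing) {g d : ℝ} (hd : 0 ≤ d) :
    m.RF g m.hatD = m.hatG - g ∧ m.RF g d ≤ m.hatG - g ∧
      (m.RF g d = m.hatG - g → d = m.hatD) := by
  have hy := hm.yA_pos
  have hyB := hm.yB_pos
  have hp := hm.pA_pos
  have hpB := hm.pB_pos
  have hf : 0 < 1 + m.f := by linarith [hm.f_nonneg]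
  obtain ⟨s, hs⟩ : ∃ s, s = √(m.pB * m.yB / ((1 + m.f) * m.pA * m.yA)) := ⟨_, rfl⟩
  have hs0 : 0 < s := by rw [hs]; positivity
  have hs2 : s ^ 2 * ((1 + m.f) * m.pA * m.yA) = m.pB * m.yB := by
    rw [hs, Real.sq_sqrt (by positivity)]; field_simp
  have hD : m.hatD = m.yA * s - m.yA := by
    have : m.yA * m.yB * m.pB / (m.pA * (1 + m.f)) = (m.yA * s) ^ 2 := by
      rw [div_eq_iff (by positivity)]
      linear_combination (-m.yA) * hs2
    rw [hatD, this, Real.sqrt_sq (by positivity)]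
  have hG : m.hatG = (1 + m.f) * m.pA * m.yA * (s - 1) ^ 2 := by rw [hatG, ← hs]
  have key : ∀ d, 0 < m.yA + d →
      m.hatG - g - m.RF g d = (1 + m.f) * m.pA * (m.yA + d - m.yA * s) ^ 2 / (m.yA + d) := by
    intro d hd
    rw [hG, RF]
    field_simp
    linear_combination (d) * hs2
  have hd' : 0 < m.yA + d := by linarith
  refine ⟨?_, ?_, fun h => ?_⟩
  · have := key m.hatD (by rw [hD]; nlinarith [mul_pos hy hs0])
    rw [hD] at this ⊢
    simp at this
    linarith
  · have : 0 ≤ m.hatG - g - m.RF g d := by rw [key d hd']; positivity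
    linarith
  · have h0 := key d hd'
    rw [h, sub_self, eq_comm, div_eq_zero_iff, or_iff_left hd'.ne', mul_eq_zero,
      or_iff_right (by positivity), sq_eq_zero_iff] at h0
    rw [hD]; linarith

end Market

end GasGame

end

/-! In equilibrium every available action earns at most some constant `K`, and almost every action
played earns exactly `K`; continuity extends this equality to every fee in the support. Since the
fee law has no atoms, trading `d` at fee `g` earns `RF g d` minus `α` times the integral of `V d (D
h) * φ h` over the fees `h` above `g`.

At the top fee the integral vanishes, and `hatD` is the only maximizer of `RF`. Optimality in the
fee gives `α * V (D g) (D g) * φ g = 1` (`density_identity`), so `φ` and `D` are positive.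
Optimality in the amount, with `V` strictly increasing in its first argument, makes `D` strictly
increasing (`amount_strictMonoOn`). As `V x x` increases with `x`, the identity then forces `φ` to
decrease. -/

noncomputable section

namespace GasGame

namespace Market

variable (m : Market)

/-! ### Monotonicity and regularity of the first-mover advantage. -/

/-- The derivative of the first-mover advantage `V` in the own trading amount. -/
def dV (d d' : ℝ) : ℝ :=
  (m.yA / (m.yA + d) ^ 2 - m.yA / (m.yA + d' + d) ^ 2) * m.yB * m.pB

variable {m}

/-- The exact difference quotient: its sign is visible because a competitor's trade only enlarges
the denominators. -/
theorem V_sub (hm : m.Standing) {d e d' : ℝ} (hd : 0 ≤ d) (he : 0 ≤ e) (hd' : 0 ≤ d') :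
    m.V d d' - m.V e d' = (d - e) * (m.yA *
      (1 / ((m.yA + d) * (m.yA + e)) - 1 / ((m.yA + d' + d) * (m.yA + d' + e))) *
        m.yB * m.pB) := by
  have h1 := hm.yA_pos
  have h2 : m.yA + d ≠ 0 := by positivity
  have h3 : m.yA + e ≠ 0 := by positivity
  have h4 : m.yA + d' ≠ 0 := by positivity
  have h5 : m.yA + d' + d ≠ 0 := by positivity
  have h6 : m.yA + d' + e ≠ 0 := by positivity
  unfold V
  field_simp
  ring

theorem V_lt_V (hm : m.Standing) {d e d' : ℝ} (hd : 0 ≤ d) (hde : d < e) (hd' : 0 < d') :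
    m.V d d' < m.V e d' := by
  have h1 := hm.yA_pos
  have h2 := hm.yB_pos
  have h3 := hm.pB_pos
  have he : 0 < e := hd.trans_lt hde
  rw [← sub_pos, V_sub hm he.le hd hd'.le]
  have h4 : 1 / ((m.yA + d' + e) * (m.yA + d' + d)) < 1 / ((m.yA + e) * (m.yA + d)) := by
    apply one_div_lt_one_div_of_lt (by positivity)
    gcongr <;> linarith
  have h5 := sub_pos.2 h4
  have h6 := sub_pos.2 hde
  positivity

theorem V_le_V (hm : m.Standing) {d e d' : ℝ} (hd : 0 ≤ d) (hde : d ≤ e) (hd' : 0 ≤ d') :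
    m.V d d' ≤ m.V e d' := by
  rcases hde.eq_or_lt with rfl | hde
  · exact le_rfl
  rcases hd'.eq_or_lt with rfl | hd'
  · have h1 := hm.yA_pos
    have h2 : m.yA + d ≠ 0 := by positivity
    have h3 : m.yA + e ≠ 0 := by linarith
    refine le_of_eq ?_
    unfold V
    simp only [add_zero]
    field_simp
    ring
  · exact (V_lt_V hm hd hde hd').le

theorem V_self_lt (hm : m.Standing) {d e : ℝ} (hd : 0 ≤ d) (hde : d < e) :
    m.V d d < m.V e e := by
  have h1 := hm.yA_pos
  have h2 := hm.yB_pos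
  have h3 := hm.pB_pos
  have he : 0 < e := hd.trans_lt hde
  -- On the diagonal `V` is a product of two increasing fractions.
  have key : ∀ x, 0 ≤ x → m.V x x =
      (x / (m.yA + x)) * (2 * x / (m.yA + x + x)) * (m.yB * m.pB) := by
    intro x hx
    have : m.yA + x ≠ 0 := by positivity
    have : m.yA + x + x ≠ 0 := by positivity
    unfold V
    field_simp
    ring
  rw [key d hd, key e he.le]
  have h4 : d / (m.yA + d) < e / (m.yA + e) := by
    rw [div_lt_div_iff₀ (by positivity) (by positivity)]
    nlinarith
  have h5 : 2 * d / (m.yA + d + d) < 2 * e / (m.yA + e + e) := by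
    rw [div_lt_div_iff₀ (by positivity) (by positivity)]
    nlinarith
  gcongr

theorem hasDerivAt_V (hm : m.Standing) {d d' : ℝ} (hd : 0 ≤ d) (hd' : 0 ≤ d') :
    HasDerivAt (fun x => m.V x d') (m.dV d d') d := by
  have h1 := hm.yA_pos
  have h2 : m.yA + d ≠ 0 := by positivity
  have h3 : m.yA + d' ≠ 0 := by positivity
  have h4 : m.yA + d' + d ≠ 0 := by positivity
  have h := (((hasDerivAt_id d).div ((hasDerivAt_id d).const_add m.yA) h2).sub
    (((hasDerivAt_id d).mul_const m.yA).div
      (((hasDerivAt_id d).const_add (m.yA + d')).const_mul (m.yA + d'))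
        (mul_ne_zero h3 h4))).mul_const m.yB |>.mul_const m.pB
  refine h.congr_deriv ?_
  unfold dV
  simp only [id]
  field_simp
  ring

theorem dV_pos (hm : m.Standing) {d d' : ℝ} (hd : 0 ≤ d) (hd' : 0 < d') : 0 < m.dV d d' := by
  have h1 := hm.yA_pos
  have h2 := hm.yB_pos
  have h3 := hm.pB_pos
  have h4 : m.yA / (m.yA + d' + d) ^ 2 < m.yA / (m.yA + d) ^ 2 := by
    gcongr
    linarith
  have := sub_pos.2 h4
  unfold dV
  positivity

/-- A bound free of `d` and `d'`, used to dominate when differentiating under the integral. -/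
theorem abs_dV_le (hm : m.Standing) {d d' : ℝ} (hd : 0 ≤ d) (hd' : 0 ≤ d') :
    |m.dV d d'| ≤ m.yA / m.yA ^ 2 * m.yB * m.pB := by
  have h1 := hm.yA_pos
  have h2 := hm.yB_pos
  have h3 := hm.pB_pos
  have h4 : m.yA / (m.yA + d' + d) ^ 2 ≤ m.yA / (m.yA + d) ^ 2 := by
    gcongr
    linarith
  have h5 : m.yA / (m.yA + d) ^ 2 ≤ m.yA / m.yA ^ 2 := by
    gcongr
    linarith
  have h6 : 0 ≤ m.yA / (m.yA + d' + d) ^ 2 := by positivity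
  have := sub_nonneg.2 h4
  unfold dV
  rw [abs_of_nonneg (by positivity)]
  gcongr
  linarith

theorem continuous_V_comp (hm : m.Standing) {X : Type*} [TopologicalSpace X] {u v : X → ℝ}
    (hu : Continuous u) (hv : Continuous v) (hu0 : ∀ x, 0 ≤ u x) (hv0 : ∀ x, 0 ≤ v x) :
    Continuous fun x => m.V (u x) (v x) := by
  have h1 := hm.yA_pos
  unfold V
  refine ((Continuous.sub ?_ ?_).mul_const _).mul_const _
  · exact hu.div (by fun_prop) fun x => by have := hu0 x; positivity
  · exact Continuous.div (by fun_prop) (by fun_prop) fun x => by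
      have := hu0 x; have := hv0 x; positivity

theorem continuous_dV_comp (hm : m.Standing) {X : Type*} [TopologicalSpace X] {v : X → ℝ} {d : ℝ}
    (hd : 0 ≤ d) (hv : Continuous v) (hv0 : ∀ x, 0 ≤ v x) :
    Continuous fun x => m.dV d (v x) := by
  have h1 := hm.yA_pos
  unfold dV
  refine ((Continuous.sub continuous_const ?_).mul_const _).mul_const _
  exact Continuous.div (by fun_prop) (by fun_prop) fun x => by have := hv0 x; positivity

/-! ### Expected profit as a function of fee and amount. -/

variable (m)

/-- The expected profit of trading the amount `d` with gas fee `g` against a competitor who trades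
with probability `α`, with gas fee density `φ` up to `gH` and trading amounts `D`. -/
def gain (α gH : ℝ) (D φ : ℝ → ℝ) (g d : ℝ) : ℝ :=
  m.RF g d - α * ∫ h in g..gH, m.V d (D h) * φ h

variable {m} {α gH : ℝ} {D φ : ℝ → ℝ}

theorem continuous_V_mul (hm : m.Standing) (hD : Continuous D) (hφ : Continuous φ)
    (hD0 : ∀ g, 0 ≤ D g) {d : ℝ} (hd : 0 ≤ d) : Continuous fun h => m.V d (D h) * φ h :=
  (continuous_V_comp hm continuous_const hD (fun _ => hd) hD0).mul hφ

/-- Raising the fee costs the increment and removes the loss to competitors whose fees lie in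
between. -/
theorem gain_sub (hm : m.Standing) (hD : Continuous D) (hφ : Continuous φ)
    (hD0 : ∀ g, 0 ≤ D g) {d : ℝ} (hd : 0 ≤ d) (g g' : ℝ) :
    m.gain α gH D φ g' d - m.gain α gH D φ g d =
      -(g' - g) + α * ∫ h in g..g', m.V d (D h) * φ h := by
  have hc := continuous_V_mul hm hD hφ hD0 hd
  have := intervalIntegral.integral_add_adjacent_intervals
    (hc.intervalIntegrable (μ := volume) g g') (hc.intervalIntegrable g' gH)
  unfold gain RF
  rw [← this]
  ring

theorem continuous_gain (hm : m.Standing) (hD : Continuous D) (hφ : Continuous φ)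
    (hD0 : ∀ g, 0 ≤ D g) : Continuous fun g => m.gain α gH D φ g (D g) := by
  have h1 := hm.yA_pos
  unfold gain
  refine Continuous.sub ?_ (continuous_const.mul ?_)
  · unfold RF
    refine ((hD.mul (Continuous.sub (Continuous.mul_const ?_ _) continuous_const))).sub
      continuous_id
    exact continuous_const.div (by fun_prop) fun x => by have := hD0 x; positivity
  -- The moving endpoint becomes the upper one; `g` also enters the integrand through `D g`.
  · simp_rw [intervalIntegral.integral_symm gH]
    refine (intervalIntegral.continuous_parametric_intervalIntegral_of_continuous
      (f := fun g h => m.V (D g) (D h) * φ h) ?_ continuous_id).neg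
    exact (continuous_V_comp hm (hD.comp continuous_fst) (hD.comp continuous_snd)
      (fun _ => hD0 _) (fun _ => hD0 _)).mul (hφ.comp continuous_snd)

theorem hasDerivAt_gain_fee (hm : m.Standing) (hD : Continuous D) (hφ : Continuous φ)
    (hD0 : ∀ g, 0 ≤ D g) {d : ℝ} (hd : 0 ≤ d) (g : ℝ) :
    HasDerivAt (fun x => m.gain α gH D φ x d) (-1 + α * (m.V d (D g) * φ g)) g := by
  have hc := continuous_V_mul hm hD hφ hD0 hd
  have h1 : HasDerivAt (fun x => m.gain α gH D φ g d +
      (-(x - g) + α * ∫ h in g..x, m.V d (D h) * φ h)) (-1 + α * (m.V d (D g) * φ g)) g :=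
    ((((hasDerivAt_id g).sub_const g).neg).add
      ((hc.integral_hasStrictDerivAt g g).hasDerivAt.const_mul α)).const_add _
  refine h1.congr_of_eventuallyEq (.of_forall fun x => ?_)
  have := gain_sub (α := α) (gH := gH) hm hD hφ hD0 hd g x
  simp only
  linarith

theorem hasDerivAt_integral_V (hm : m.Standing) (hD : Continuous D) (hφ : Continuous φ)
    (hD0 : ∀ g, 0 ≤ D g) {d : ℝ} (hd : 0 < d) (a b : ℝ) :
    HasDerivAt (fun x => ∫ h in a..b, m.V x (D h) * φ h) (∫ h in a..b, m.dV d (D h) * φ h) d := by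
  refine (intervalIntegral.hasDerivAt_integral_of_dominated_loc_of_deriv_le
    (F := fun x h => m.V x (D h) * φ h) (F' := fun x h => m.dV x (D h) * φ h) (s := Ioi 0)
    (bound := fun h => m.yA / m.yA ^ 2 * m.yB * m.pB * |φ h|) (Ioi_mem_nhds hd) ?_ ?_ ?_ ?_ ?_ ?_).2
  · filter_upwards [Ioi_mem_nhds hd] with x hx
    exact (continuous_V_mul hm hD hφ hD0 (le_of_lt hx)).aestronglyMeasurable
  · exact (continuous_V_mul hm hD hφ hD0 hd.le).intervalIntegrable _ _
  · exact ((continuous_dV_comp hm hd.le hD hD0).mul hφ).aestronglyMeasurable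
  · refine .of_forall fun h _ x hx => ?_
    rw [norm_mul, Real.norm_eq_abs, Real.norm_eq_abs]
    gcongr
    exact abs_dV_le hm (le_of_lt hx) (hD0 h)
  · exact (continuous_const.mul hφ.abs).intervalIntegrable _ _
  · exact .of_forall fun h _ x hx => (hasDerivAt_V hm (le_of_lt hx) (hD0 h)).mul_const _

/-! ### First-order conditions and monotonicity. -/

/-- A best reply against itself: no available action gains more than `K`, and the actions
`(g, D g)` with `g ∈ [gL, gH]` gain exactly `K`. -/
structure IsBestReply (m : Market) (α gH K : ℝ) (D φ : ℝ → ℝ) : Prop where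
  α_pos : 0 < α
  gH_mem : m.gL < gH
  amount_cont : Continuous D
  density_cont : Continuous φ
  amount_mem : ∀ g, D g ∈ Icc 0 m.hatD
  density_nonneg : ∀ g, 0 ≤ φ g
  gain_le : ∀ g ∈ Icc m.gL gH, ∀ d ∈ Icc 0 m.hatD, m.gain α gH D φ g d ≤ K
  gain_eq : ∀ g ∈ Icc m.gL gH, m.gain α gH D φ g (D g) = K

namespace IsBestReply

variable {K : ℝ}

theorem amount_nonneg (h : m.IsBestReply α gH K D φ) (g : ℝ) : 0 ≤ D g := (h.amount_mem g).1

theorem amount_top (h : m.IsBestReply α gH K D φ) (hm : m.Standing) : D gH = m.hatD := by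
  have hH : gH ∈ Icc m.gL gH := right_mem_Icc.2 h.gH_mem.le
  have hhat : 0 ≤ m.hatD := (h.amount_mem gH).1.trans (h.amount_mem gH).2
  have h1 := h.gain_eq gH hH
  have h2 := h.gain_le gH hH m.hatD (right_mem_Icc.2 hhat)
  simp only [gain, intervalIntegral.integral_same, mul_zero, sub_zero] at h1 h2
  obtain ⟨h3, h4, h5⟩ := RF_le m hm (g := gH) (h.amount_nonneg gH)
  exact h5 (by linarith)

/-- The first-order condition in the fee, with the amount held at `D g`: it holds at interior fees
and passes to the endpoints by continuity. -/
theorem density_identity (h : m.IsBestReply α gH K D φ) (hm : m.Standing) {g : ℝ}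
    (hg : g ∈ Icc m.gL gH) : α * (m.V (D g) (D g) * φ g) = 1 := by
  have hD0 := h.amount_nonneg
  have hint : EqOn (fun g => α * (m.V (D g) (D g) * φ g)) (fun _ => 1) (Ioo m.gL gH) := by
    intro g hg
    have hmax : IsLocalMax (fun x => m.gain α gH D φ x (D g)) g := by
      filter_upwards [Icc_mem_nhds hg.1 hg.2] with x hx
      rw [h.gain_eq g (Ioo_subset_Icc_self hg)]
      exact h.gain_le x hx _ (h.amount_mem g)
    have := hmax.hasDerivAt_eq_zero
      (hasDerivAt_gain_fee hm h.amount_cont h.density_cont hD0 (hD0 g) g)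
    simp only
    linarith
  have hcont : Continuous fun g => α * (m.V (D g) (D g) * φ g) :=
    continuous_const.mul
      ((continuous_V_comp hm h.amount_cont h.amount_cont hD0 hD0).mul h.density_cont)
  have := hint.closure hcont continuous_const
  rw [closure_Ioo h.gH_mem.ne] at this
  exact this hg

theorem density_pos (h : m.IsBestReply α gH K D φ) (hm : m.Standing) {g : ℝ}
    (hg : g ∈ Icc m.gL gH) : 0 < φ g := by
  refine (h.density_nonneg g).lt_of_ne fun h0 => ?_
  have := h.density_identity hm hg
  rw [← h0] at this
  simp at this

theorem amount_pos (h : m.IsBestReply α gH K D φ) (hm : m.Standing) {g : ℝ}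
    (hg : g ∈ Icc m.gL gH) : 0 < D g := by
  refine (h.amount_nonneg g).lt_of_ne fun h0 => ?_
  have := h.density_identity hm hg
  rw [← h0] at this
  simp [V] at this

/-- Beyond `hatD` the first mover's profit is no higher and the loss no lower. Thus `D g` is a
two-sided local maximum in the amount even if it equals `hatD`. -/
theorem gain_le_of_nonneg (h : m.IsBestReply α gH K D φ) (hm : m.Standing) {g d : ℝ}
    (hg : g ∈ Icc m.gL gH) (hd : 0 ≤ d) : m.gain α gH D φ g d ≤ K := by
  have hD0 := h.amount_nonneg
  have hhat : 0 ≤ m.hatD := (h.amount_mem gH).1.trans (h.amount_mem gH).2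
  rcases le_total d m.hatD with hd' | hd'
  · exact h.gain_le g hg d ⟨hd, hd'⟩
  refine le_trans ?_ (h.gain_le g hg m.hatD (right_mem_Icc.2 hhat))
  have h1 : m.RF g d ≤ m.RF g m.hatD := by
    obtain ⟨h3, h4, -⟩ := RF_le m hm (g := g) hd
    linarith
  have h2 : ∫ x in g..gH, m.V m.hatD (D x) * φ x ≤ ∫ x in g..gH, m.V d (D x) * φ x := by
    refine intervalIntegral.integral_mono_on hg.2
      ((continuous_V_mul hm h.amount_cont h.density_cont hD0 hhat).intervalIntegrable _ _)
      ((continuous_V_mul hm h.amount_cont h.density_cont hD0 hd).intervalIntegrable _ _)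
      fun x _ => ?_
    exact mul_le_mul_of_nonneg_right (V_le_V hm hhat hd' (hD0 x)) (h.density_nonneg x)
  unfold gain
  have := mul_le_mul_of_nonneg_left h2 h.α_pos.le
  linarith

theorem amount_strictMonoOn (h : m.IsBestReply α gH K D φ) (hm : m.Standing) :
    StrictMonoOn D (Icc m.gL gH) := by
  intro g hg g' hg' hgg'
  have hD0 := h.amount_nonneg
  have hsub : ∀ x ∈ Ioo g g', x ∈ Icc m.gL gH := fun x hx =>
    ⟨hg.1.trans hx.1.le, hx.2.le.trans hg'.2⟩
  have hV : ∀ d, 0 ≤ d → Continuous fun x => m.V d (D x) * φ x := fun d hd =>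
    continuous_V_mul hm h.amount_cont h.density_cont hD0 hd
  rcases lt_trichotomy (D g) (D g') with hlt | heq | hgt
  · exact hlt
  -- Equal amounts would satisfy the first-order condition in the amount at both fees, but the two
  -- derivatives differ by `α` times the positive integral of `dV * φ` between the fees.
  · exfalso
    have hd := h.amount_pos hm hg
    have hmax : IsLocalMax (fun x => m.gain α gH D φ g x) (D g) := by
      filter_upwards [Ioi_mem_nhds hd] with x hx
      rw [h.gain_eq g hg]
      exact h.gain_le_of_nonneg hm hg (le_of_lt hx)
    have hmax' : IsLocalMax (fun x => m.gain α gH D φ g' x) (D g) := by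
      filter_upwards [Ioi_mem_nhds hd] with x hx
      rw [heq, h.gain_eq g' hg']
      exact h.gain_le_of_nonneg hm hg' (le_of_lt hx)
    have hRF : DifferentiableAt ℝ (fun x => m.RF g' x) (D g) := by
      have h1 := hm.yA_pos
      have : m.yA + D g ≠ 0 := by positivity
      unfold RF
      fun_prop (disch := assumption)
    have hder' := hRF.hasDerivAt.sub
      ((hasDerivAt_integral_V hm h.amount_cont h.density_cont hD0 hd g' gH).const_mul α)
    have h1 := hmax'.hasDerivAt_eq_zero hder'
    have hder : HasDerivAt (fun x => m.gain α gH D φ g x) (0 -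
        (α * ∫ x in g..g', m.dV (D g) (D x) * φ x)) (D g) := by
      rw [h1] at hder'
      refine ((hder'.sub ((hasDerivAt_integral_V hm h.amount_cont h.density_cont hD0 hd
        g g').const_mul α)).const_add (g' - g)).congr_of_eventuallyEq ?_
      filter_upwards [Ioi_mem_nhds hd] with x hx
      have := gain_sub (α := α) (gH := gH) hm h.amount_cont h.density_cont hD0 (le_of_lt hx) g g'
      simp only [gain, Pi.sub_apply] at this ⊢
      linarith
    have h2 := hmax.hasDerivAt_eq_zero hder
    have h3 : 0 < ∫ x in g..g', m.dV (D g) (D x) * φ x := by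
      refine intervalIntegral.intervalIntegral_pos_of_pos_on
        (((continuous_dV_comp hm hd.le h.amount_cont hD0).mul
          h.density_cont).intervalIntegrable _ _) (fun x hx => ?_) hgg'
      exact mul_pos (dV_pos hm hd.le (h.amount_pos hm (hsub x hx))) (h.density_pos hm (hsub x hx))
    have := mul_pos h.α_pos h3
    linarith
  -- Exchange argument: neither fee gains by taking the other's amount, so `α` times the integral of
  -- `V (D g) (D x) * φ x` is at most `g' - g`, and with `D g'` at least `g' - g`. This contradicts
  -- strict monotonicity of `V`.
  · exfalso
    have h1 := gain_sub (α := α) (gH := gH) hm h.amount_cont h.density_cont hD0 (hD0 g) g g'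
    have h2 := gain_sub (α := α) (gH := gH) hm h.amount_cont h.density_cont hD0 (hD0 g') g g'
    rw [h.gain_eq g hg] at h1
    rw [h.gain_eq g' hg'] at h2
    have h3 := h.gain_le g' hg' (D g) (h.amount_mem g)
    have h4 := h.gain_le g hg (D g') (h.amount_mem g')
    have h5 : 0 < ∫ x in g..g', (m.V (D g) (D x) * φ x - m.V (D g') (D x) * φ x) := by
      refine intervalIntegral.intervalIntegral_pos_of_pos_on
        (((hV _ (hD0 g)).sub (hV _ (hD0 g'))).intervalIntegrable _ _) (fun x hx => ?_) hgg'
      rw [← sub_mul]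
      exact mul_pos (sub_pos.2 (V_lt_V hm (hD0 g') hgt (h.amount_pos hm (hsub x hx))))
        (h.density_pos hm (hsub x hx))
    rw [intervalIntegral.integral_sub ((hV _ (hD0 g)).intervalIntegrable _ _)
      ((hV _ (hD0 g')).intervalIntegrable _ _)] at h5
    have := mul_pos h.α_pos h5
    linarith

theorem density_strictAntiOn (h : m.IsBestReply α gH K D φ) (hm : m.Standing) :
    StrictAntiOn φ (Icc m.gL gH) := by
  intro g hg g' hg' hgg'
  have h1 := h.density_identity hm hg
  have h2 := h.density_identity hm hg'
  have h3 := V_self_lt hm (h.amount_nonneg g) (h.amount_strictMonoOn hm hg hg' hgg')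
  have h4 := h.density_pos hm hg'
  have h5 := h.α_pos
  by_contra! hle
  have h6 : 0 < m.V (D g) (D g) := by
    simpa [V] using V_self_lt hm le_rfl (h.amount_pos hm hg)
  have h7 : m.V (D g) (D g) * φ g < m.V (D g') (D g') * φ g' := by
    calc m.V (D g) (D g) * φ g ≤ m.V (D g) (D g) * φ g' := by gcongr
      _ < _ := by gcongr
  have := mul_lt_mul_of_pos_left h7 h5
  linarith

end IsBestReply

end Market

/-! ### From Nash equilibrium to pointwise optimality. -/

namespace Market

variable (m : Market)

/-- The expected profit of trading with the action `a` against a competitor who trades with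
probability `α` and chooses his action with law `μ`. -/
def profit (α : ℝ) (μ : Measure (ℝ × ℝ)) (a : ℝ × ℝ) : ℝ :=
  (1 - α) * m.RF a.1 a.2 + α * ∫ b, m.payoff a b ∂μ

theorem measurable_RF : Measurable fun a : ℝ × ℝ => m.RF a.1 a.2 := by
  unfold RF
  fun_prop

theorem measurable_payoff : Measurable fun p : (ℝ × ℝ) × (ℝ × ℝ) => m.payoff p.1 p.2 := by
  have h1 : Measurable fun p : (ℝ × ℝ) × (ℝ × ℝ) => m.RF p.1.1 p.1.2 :=
    m.measurable_RF.comp measurable_fst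
  have h2 : Measurable fun p : (ℝ × ℝ) × (ℝ × ℝ) => m.RS p.1.1 p.1.2 p.2.2 := by
    unfold RS V
    exact h1.sub (by fun_prop)
  unfold payoff
  refine Measurable.ite (measurableSet_lt (by fun_prop) (by fun_prop)) h1
    (Measurable.ite (measurableSet_eq_fun (by fun_prop) (by fun_prop)) ?_ h2)
  exact (h1.add h2).const_mul _

theorem measurable_payoff_left (a : ℝ × ℝ) : Measurable (m.payoff a) :=
  m.measurable_payoff.comp measurable_prodMk_left

theorem expectedPayoff_dirac (a : ℝ × ℝ) (α : ℝ) (μ : Measure (ℝ × ℝ)) [SFinite μ] :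
    m.expectedPayoff 1 (.dirac a) α μ = m.profit α μ a := by
  unfold expectedPayoff profit
  rw [integral_dirac, Measure.dirac_prod, integral_map (by fun_prop)
    m.measurable_payoff.aestronglyMeasurable]
  ring

variable {m}

theorem measurableSet_actions : MeasurableSet m.actions :=
  measurableSet_Icc.prod measurableSet_Icc

theorem isCompact_actions : IsCompact m.actions := isCompact_Icc.prod isCompact_Icc

/-- The payoff jumps at ties, but `|RF| + |RS|` dominates it and is continuous on a compact set. All
integrability follows from this. -/
theorem exists_bound (hm : m.Standing) : ∃ C, ∀ a ∈ m.actions, ∀ b ∈ m.actions,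
    |m.RF a.1 a.2| ≤ C ∧ |m.payoff a b| ≤ C := by
  have h1 := hm.yA_pos
  have hc : ContinuousOn (fun p : (ℝ × ℝ) × (ℝ × ℝ) =>
      |m.RF p.1.1 p.1.2| + |m.RS p.1.1 p.1.2 p.2.2|) (m.actions ×ˢ m.actions) := by
    intro p hp
    have h2 : 0 ≤ p.1.2 := hp.1.2.1
    have h3 : 0 ≤ p.2.2 := hp.2.2.1
    have h4 : m.yA + p.1.2 ≠ 0 := by positivity
    have h5 : (m.yA + p.2.2) * (m.yA + p.2.2 + p.1.2) ≠ 0 := by positivity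
    refine ContinuousAt.continuousWithinAt ?_
    unfold RS RF V
    fun_prop (disch := assumption)
  obtain ⟨C, hC⟩ := (isCompact_actions.prod isCompact_actions).exists_bound_of_continuousOn hc
  refine ⟨C, fun a ha b hb => ?_⟩
  have h2 := hC (a, b) ⟨ha, hb⟩
  rw [Real.norm_eq_abs, abs_of_nonneg (by positivity)] at h2
  simp only at h2
  have h3 := abs_nonneg (m.RF a.1 a.2)
  have h4 := abs_nonneg (m.RS a.1 a.2 b.2)
  refine ⟨by linarith, ?_⟩
  unfold payoff
  split_ifs
  · linarith
  · rw [abs_mul, abs_of_pos (by norm_num : (0 : ℝ) < 1 / 2)]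
    have := abs_add_le (m.RF a.1 a.2) (m.RS a.1 a.2 b.2)
    linarith
  · linarith

theorem IsMixedStrategy.ae_mem {α : ℝ} {μ : Measure (ℝ × ℝ)} (h : m.IsMixedStrategy α μ) :
    ∀ᵐ a ∂μ, a ∈ m.actions := h.2.2

theorem IsMixedStrategy.integrable_RF (hm : m.Standing) {α : ℝ} {μ : Measure (ℝ × ℝ)}
    (h : m.IsMixedStrategy α μ) : Integrable (fun a => m.RF a.1 a.2) μ := by
  have := h.2.1
  obtain ⟨C, hC⟩ := exists_bound hm
  refine .of_bound m.measurable_RF.aestronglyMeasurable C ?_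
  filter_upwards [h.ae_mem] with a ha using (hC a ha a ha).1

theorem IsMixedStrategy.integrable_payoff (hm : m.Standing) {α : ℝ} {μ : Measure (ℝ × ℝ)}
    (h : m.IsMixedStrategy α μ) :
    Integrable (fun p : (ℝ × ℝ) × (ℝ × ℝ) => m.payoff p.1 p.2) (μ.prod μ) := by
  have := h.2.1
  obtain ⟨C, hC⟩ := exists_bound hm
  refine .of_bound m.measurable_payoff.aestronglyMeasurable C ?_
  filter_upwards [Measure.quasiMeasurePreserving_fst.ae h.ae_mem,
    Measure.quasiMeasurePreserving_snd.ae h.ae_mem] with p hp hq using (hC _ hp _ hq).2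

theorem IsMixedStrategy.integrable_profit (hm : m.Standing) {α : ℝ} {μ : Measure (ℝ × ℝ)}
    (h : m.IsMixedStrategy α μ) : Integrable (m.profit α μ) μ := by
  have := h.2.1
  exact ((h.integrable_RF hm).const_mul _).add
    ((h.integrable_payoff hm).integral_prod_left.const_mul _)

theorem IsMixedStrategy.expectedPayoff_self (hm : m.Standing) {α : ℝ} {μ : Measure (ℝ × ℝ)}
    (h : m.IsMixedStrategy α μ) :
    m.expectedPayoff α μ α μ = α * ∫ a, m.profit α μ a ∂μ := by
  have := h.2.1
  unfold expectedPayoff profit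
  rw [integral_prod _ (h.integrable_payoff hm), integral_add ((h.integrable_RF hm).const_mul _)
    ((h.integrable_payoff hm).integral_prod_left.const_mul _), integral_const_mul,
    integral_const_mul]
  ring

/-- Let `E` be the mean profit given trade. Trading surely with a pure action earns at most `α * E`,
and not trading shows `0 ≤ α * E`. Hence every profit is at most `α * E ≤ E`; since `E` is the mean,
it is attained almost surely. -/
theorem IsSymmetricMixedNash.exists_profit_le (hm : m.Standing) {α : ℝ} {μ : Measure (ℝ × ℝ)}
    (hα : 0 < α) (h : m.IsSymmetricMixedNash α μ) :
    ∃ K, (∀ a ∈ m.actions, m.profit α μ a ≤ K) ∧ ∀ᵐ a ∂μ, m.profit α μ a = K := by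
  have := h.1.2.1
  have hself := h.1.expectedPayoff_self hm
  have hdev : ∀ a ∈ m.actions, m.profit α μ a ≤ α * ∫ a, m.profit α μ a ∂μ := by
    intro a ha
    rw [← hself, ← expectedPayoff_dirac]
    refine h.2 1 _ ⟨by simp, inferInstance, ?_⟩
    rw [Measure.dirac_apply' _ measurableSet_actions.compl]
    simpa using ha
  have h0 : 0 ≤ α * ∫ a, m.profit α μ a ∂μ := by
    rw [← hself]
    simpa [expectedPayoff] using h.2 0 μ ⟨by simp, h.1.2⟩
  have hE : 0 ≤ ∫ a, m.profit α μ a ∂μ := nonneg_of_mul_nonneg_right h0 hα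
  have hle : α * ∫ a, m.profit α μ a ∂μ ≤ ∫ a, m.profit α μ a ∂μ :=
    mul_le_of_le_one_left hE h.1.1.2
  refine ⟨∫ a, m.profit α μ a ∂μ, fun a ha => (hdev a ha).trans hle, ?_⟩
  have hnn : 0 ≤ᵐ[μ] fun a => (∫ a, m.profit α μ a ∂μ) - m.profit α μ a := by
    filter_upwards [h.1.ae_mem] with a ha using sub_nonneg.2 ((hdev a ha).trans hle)
  have hint := h.1.integrable_profit hm
  have hz : ∫ b, ((∫ a, m.profit α μ a ∂μ) - m.profit α μ b) ∂μ = 0 := by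
    rw [integral_sub (integrable_const _) hint]
    simp
  filter_upwards [(integral_eq_zero_iff_of_nonneg_ae hnn ((integrable_const _).sub hint)).1 hz]
    with a ha
  exact (sub_eq_zero.1 ha).symm

/-- The profit against a strategy with a gas fee density is the first mover's profit minus the
expected loss from competitors with a higher gas fee. -/
theorem profit_eq_gain (hm : m.Standing) {α gH : ℝ} {D φ : ℝ → ℝ} {Φ : Measure ℝ}
    [IsProbabilityMeasure Φ] (hD : Continuous D) (hφ : Continuous φ) (hD0 : ∀ g, 0 ≤ D g)
    (hφ0 : ∀ g, 0 ≤ φ g) (hΦ : Φ = (volume.restrict (Icc m.gL gH)).withDensity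
      fun g => ENNReal.ofReal (φ g)) {g d : ℝ} (hg : g ∈ Icc m.gL gH) (hd : 0 ≤ d) :
    m.profit α (Φ.map fun g => (g, D g)) (g, d) = m.gain α gH D φ g d := by
  have hV : Continuous fun x => m.V d (D x) :=
    continuous_V_comp hm continuous_const hD (fun _ => hd) hD0
  have hint : ∫ x in Ioi g, m.V d (D x) ∂Φ = ∫ x in g..gH, m.V d (D x) * φ x := by
    rw [intervalIntegral.integral_of_le hg.2, hΦ, restrict_withDensity measurableSet_Ioi,
      Measure.restrict_restrict measurableSet_Ioi,
      integral_withDensity_eq_integral_toReal_smul₀ (by fun_prop) (by simp)]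
    have hset : Ioi g ∩ Icc m.gL gH = Ioc g gH := by
      ext x
      simp only [mem_inter_iff, mem_Ioi, mem_Icc, mem_Ioc]
      exact ⟨fun h => ⟨h.1, h.2.2⟩, fun h => ⟨h.1, hg.1.trans h.1.le, h.2⟩⟩
    rw [hset]
    refine integral_congr_ae (.of_forall fun x => ?_)
    simp only [ENNReal.toReal_ofReal (hφ0 x), smul_eq_mul, mul_comm]
  -- Ties are null because the law has a density.
  have hatom : ∀ᵐ x ∂Φ, x ≠ g := by
    rw [hΦ]
    exact (withDensity_absolutelyContinuous _ _).ae_le (Measure.ae_ne _ g)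
  have hpay : ∫ b, m.payoff (g, d) b ∂(Φ.map fun g => (g, D g)) =
      m.RF g d - ∫ x in Ioi g, m.V d (D x) ∂Φ := by
    have hon : IntegrableOn (fun x => m.V d (D x)) (Ioi g) Φ := by
      obtain ⟨C, hC⟩ := (isCompact_Icc (a := m.gL) (b := gH)).exists_bound_of_continuousOn
        hV.continuousOn
      refine Integrable.integrableOn (.of_bound hV.aestronglyMeasurable C ?_)
      rw [hΦ]
      refine (withDensity_absolutelyContinuous _ _).ae_le ?_
      filter_upwards [ae_restrict_mem measurableSet_Icc] with x hx using hC x hx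
    rw [integral_map (by fun_prop) (m.measurable_payoff_left _).aestronglyMeasurable,
      ← integral_indicator measurableSet_Ioi]
    have : m.RF g d = ∫ _, m.RF g d ∂Φ := by simp
    rw [this, ← integral_sub (integrable_const _) (hon.integrable_indicator measurableSet_Ioi)]
    refine integral_congr_ae ?_
    filter_upwards [hatom] with x hx
    rcases lt_or_gt_of_ne hx with hlt | hgt
    · simp [payoff, hlt, hlt.not_gt, indicator]
    · simp [payoff, hgt, hgt.ne', hgt.not_gt, indicator, RS]
  unfold profit gain
  rw [hpay, hint]
  ring

/-- A symmetric equilibrium in the class is a best reply against itself, after its amount and its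
density have been extended continuously beyond the support. -/
theorem InClass.exists_isBestReply (hm : m.Standing) {σ : Strategy} {gH : ℝ} {φ : ℝ → ℝ}
    (hσ : m.InClass σ gH φ) (heq : m.IsSymmetricMixedNash σ.α σ.law) :
    ∃ K D ψ, EqOn D σ.D (Icc m.gL gH) ∧ EqOn ψ φ (Icc m.gL gH) ∧
      m.IsBestReply σ.α gH K D ψ := by
  have hlt : m.gL < gH := hσ.gH_mem.1
  have := hσ.isProb
  obtain ⟨D, hD⟩ : ∃ D, D = IccExtend hlt.le ((Icc m.gL gH).domRestrict σ.D) := ⟨_, rfl⟩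
  obtain ⟨ψ, hψ⟩ : ∃ ψ, ψ = IccExtend hlt.le ((Icc m.gL gH).domRestrict φ) := ⟨_, rfl⟩
  have hDeq : EqOn D σ.D (Icc m.gL gH) := fun x hx => by rw [hD, IccExtend_of_mem _ _ hx]; rfl
  have hψeq : EqOn ψ φ (Icc m.gL gH) := fun x hx => by rw [hψ, IccExtend_of_mem _ _ hx]; rfl
  have hDc : Continuous D := hD ▸ hσ.amount_cont.domRestrict.Icc_extend'
  have hψc : Continuous ψ := hψ ▸ hσ.density_cont.domRestrict.Icc_extend'
  have hψ0 : ∀ g, 0 ≤ ψ g := fun g => by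
    rw [hψ]; exact hσ.density_nonneg _ (projIcc m.gL gH hlt.le g).2
  have hΦ : σ.Φ = (volume.restrict (Icc m.gL gH)).withDensity fun g => ENNReal.ofReal (ψ g) := by
    rw [hσ.density_eq]
    refine withDensity_congr_ae ?_
    filter_upwards [ae_restrict_mem measurableSet_Icc] with x hx
    rw [hψeq hx]
  have hmem : ∀ᵐ x ∂σ.Φ, x ∈ Icc m.gL gH := by
    rw [hΦ]
    exact (withDensity_absolutelyContinuous _ _).ae_le (ae_restrict_mem measurableSet_Icc)
  have hlaw : σ.law = σ.Φ.map fun g => (g, D g) := by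
    refine Measure.map_congr ?_
    filter_upwards [hmem] with x hx
    rw [hDeq hx]
  have hgraph : Continuous fun g => (g, D g) := by fun_prop
  -- An almost sure closed property holds on the whole support.
  have hsupp : ∀ s : Set ℝ, IsClosed s → (∀ᵐ x ∂σ.Φ, x ∈ s) → Icc m.gL gH ⊆ s := fun s hs h => by
    rw [← hσ.support_eq]
    exact Measure.support_subset_of_isClosed hs h
  have hact : ∀ g ∈ Icc m.gL gH, (g, D g) ∈ m.actions := by
    refine hsupp ((fun g => (g, D g)) ⁻¹' m.actions)
      (isCompact_actions.isClosed.preimage hgraph) ?_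
    have := heq.1.ae_mem
    rw [hlaw] at this
    exact ae_of_ae_map hgraph.aemeasurable this
  -- The extension takes no new values, so bounds on the interval hold everywhere.
  have hDmem : ∀ g, D g ∈ Icc 0 m.hatD := fun g => by
    have h := (hact _ (projIcc m.gL gH hlt.le g).2).2
    rw [hDeq (projIcc m.gL gH hlt.le g).2] at h
    rw [hD]
    exact h
  have hD0 : ∀ g, 0 ≤ D g := fun g => (hDmem g).1
  have hgain : ∀ g ∈ Icc m.gL gH, ∀ d, 0 ≤ d →
      m.profit σ.α σ.law (g, d) = m.gain σ.α gH D ψ g d := fun g hg d hd => by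
    rw [hlaw]
    exact profit_eq_gain hm hDc hψc hD0 hψ0 hΦ hg hd
  obtain ⟨K, hK, hKeq⟩ := heq.exists_profit_le hm hσ.α_mem.1
  refine ⟨K, D, ψ, hDeq, hψeq, hσ.α_mem.1, hlt, hDc, hψc, hDmem, hψ0, fun g hg d hd => ?_, ?_⟩
  · rw [← hgain g hg d hd.1]
    exact hK _ ⟨⟨hg.1, hg.2.trans hσ.gH_mem.2⟩, hd⟩
  -- Indifference holds only almost surely at first; the set of fees where it holds is closed, so it
  -- contains the support.
  · refine hsupp {g | m.gain σ.α gH D ψ g (D g) = K}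
      (isClosed_eq (continuous_gain hm hDc hψc hD0) continuous_const) ?_
    rw [hlaw] at hKeq
    filter_upwards [ae_of_ae_map hgraph.aemeasurable hKeq, hmem] with g hg hg'
    rw [← hlaw, hgain g hg' _ (hD0 g)] at hg
    exact hg

end Market

end GasGame

end

theorem mainTheorem6 (m : GasGame.Market) (hm : m.Standing) (hO : m.O ≤ 3)
    (σ : GasGame.Strategy) (gH : ℝ) (φ : ℝ → ℝ) (hσ : m.InClass σ gH φ)
    (heq : m.IsSymmetricMixedNash σ.α σ.law) :
    (StrictMonoOn σ.D (Set.Icc m.gL gH) ∧ σ.D gH = m.hatD) ∧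
      StrictAntiOn φ (Set.Icc m.gL gH) := by
  obtain ⟨K, D, ψ, hD, hψ, h⟩ := hσ.exists_isBestReply hm heq
  refine ⟨⟨(h.amount_strictMonoOn hm).congr hD, ?_⟩, (h.density_strictAntiOn hm).congr hψ⟩
  rw [← hD (Set.right_mem_Icc.2 h.gH_mem.le)]
  exact h.amount_top hm
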